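/- Let $\mathcal{C}$ be a bicategory. *Conventions.* For 1-cells $f:A\to B$, $g:C\to D$ write $f\perp g$ if the square of hom-categories with corners $\mathcal{C}[B,C]$, $\mathcal{C}[A,C]$, $\mathcal{C}[B,D]$, $\mathcal{C}[A,D]$ is a bipullback in $\mathbf{Cat}$, i.e. if $s\mapsto (sf, gs, g(sf)\cong(gs)f)$ is an equivalence from $\mathcal{C}[B,C]$ to the category of pseudosquares from $f$ to $g$. A *bifactorization system* on $\mathcal{C}$ is a pair $(\mathcal{L},\mathcal{R})$ of classes of 1-cells with $\mathcal{L}={}^{\perp}\mathcal{R}$ and $\mathcal{R}=\mathcal{L}^{\perp}$ such that every 1-cell $f$ admits an invertible 2-cell $r_fl_f\cong f$ with $l_f\in\mathcal{L}$, $r_f\in\mathcal{R}$, and every other such factorization $rl\cong f$ is related to it by an equivalence $i$ with invertible 2-cells $il\cong l_f$, $r\cong r_fi$ compatible with the two factorizations, the triple being unique up to a unique invertible 2-cell. An object $1$ is *biterminal* if each $\mathcal{C}[A,1]$ is equivalent to the terminal category. The *pseudoslice* $\mathcal{C}/C$ has as 0-cells the 1-cells $a:A\to C$, as 1-cells $a\to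 b$ the pairs $(u,\alpha)$ with $\alpha: bu\cong a$ invertible, and as 2-cells $(u,\alpha)\Rightarrow(u',\alpha')$ the 2-cells $\phi:u\Rightarrow u'$ with $\alpha'\cdot(b\phi)=\alpha$. The dual $(-)^{\mathrm{op}}$ of a bicategory reverses 1-cells only. Let $U:\mathcal{A}\to\mathcal{B}$ be a pseudofunctor. A 1-cell $n:B\to U(A)$ is *$U$-generic* if * for all $u:A_1\to A_2$, $v:A\to A_2$, $f:B\to U(A_1)$ and invertible $\alpha:U(u)f\cong U(v)n$ there are $w:A\to A_1$ and invertible 2-cells $\nu: f\cong U(w)n$, $\omega: uw\cong v$ such that $\alpha$ is the pasting of $\nu$ and $U(\omega)$, and the triple $(w,\nu,\omega)$ is unique up to a unique invertible 2-cell; * for $u,v$ fixed, any 2-cell $\phi:f_1\Rightarrow f_2$ with $\alpha_2\cdot(U(u)\phi)=\alpha_1$ and any triples $(w_i,\nu_i,\omega_i)$ as above for $\alpha_i$, there is a unique $\sigma:w_1\Rightarrow w_2$ with $\omega_2\cdot(u\sigma)=\omega_1$ and $\nu_2\cdot\phi=(U(\sigma)n)\cdot\nu_1$. $U$ is *bistable*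 if each $f:B\to U(A)$ admits an invertible 2-cell $U(u_f)n_f\cong f$ with $n_f: B\to U(A_f)$ $U$-generic and $u_f:A_f\to A$, and every other such factorization $U(u)n\cong f$ with $n:B\to U(A')$ $U$-generic is related to it by an equivalence $e:A'\to A_f$ with invertible 2-cells $n_f\cong U(e)n$ and $u_fe\cong u$ compatible with the two factorizations, the triple being unique up to a unique invertible 2-cell. **Theorem.** Let $(\mathcal{L},\mathcal{R})$ be a bifactorization system on a bicategory $\mathcal{C}$ with a biterminal object $1$. 1. Let $\mathcal{L}\text{-}\mathbf{Obj}$ be the sub-bicategory of $\mathcal{C}$ whose 0-cells are the objects $A$ whose terminal map $A\to 1$ is in $\mathcal{L}$, whose 1-cells are the $\mathcal{L}$-maps between them, and whose 2-cells are all 2-cells of $\mathcal{C}$ between those. Then the opposite of its inclusion, $\iota_{\mathcal{L}}^{\mathrm{op}}:\mathcal{L}\text{-}\mathbf{Obj}^{\mathrm{op}}\to\mathcal{C}^{\mathrm{op}}$, is bistable, and a 1-cell $B\to\iota_{\mathcal{L}}^{\mathrm{op}}(A)$ in $\mathcal{C}^{\mathrm{op}}$ is $\iota_{\mathcal{L}}^{\mathrm{op}}$-generic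 if and only if the corresponding 1-cell $A\to B$ of $\mathcal{C}$ is in $\mathcal{R}$. 2. For each object $C$ of $\mathcal{C}$, let $\mathcal{L}\text{-}\mathbf{Obj}_C$ be the sub-bicategory of $\mathcal{C}/C$ whose 0-cells are the $\mathcal{L}$-maps $a:A\to C$, whose 1-cells are the $(u,\alpha)$ with $u\in\mathcal{L}$, and whose 2-cells are all 2-cells of $\mathcal{C}/C$ between those. Then the opposite of its inclusion, $\iota_{\mathcal{L},C}^{\mathrm{op}}:\mathcal{L}\text{-}\mathbf{Obj}_C^{\mathrm{op}}\to(\mathcal{C}/C)^{\mathrm{op}}$, is bistable, and a 1-cell $b\to\iota_{\mathcal{L},C}^{\mathrm{op}}(a)$ in $(\mathcal{C}/C)^{\mathrm{op}}$ is $\iota_{\mathcal{L},C}^{\mathrm{op}}$-generic if and only if the corresponding 1-cell $(r,\rho):a\to b$ of $\mathcal{C}/C$ has $r\in\mathcal{R}$. -/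

import Mathlib

open CategoryTheory Bicategory Opposite Bicategory.Opposite

universe w v u w₁ v₁ u₁ w₂ v₂ u₂

namespace BistableInclusion

section Orthogonality

variable {C : Type u} [Bicategory.{w, v} C]

/-- The canonical comparison functor from `C[b, c]` to the category of pseudosquares from `f` to
`g`, i.e. to the pseudopullback of `C[a, g]` and `C[f, d]`.  Objects of the target are triples
`(u, v, α)` with `α : u ≫ g ≅ f ≫ v`, its morphisms are morphisms of pseudosquares; a diagonal `s`
is sent to `(f ≫ s, s ≫ g, associator)`. -/
def orthComparison {a b c d : C} (f : a ⟶ b) (g : c ⟶ d) :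
    (b ⟶ c) ⥤ Limits.CategoricalPullback (postcomp a g) (precomp d f) where
  obj s := ⟨f ≫ s, s ≫ g, α_ f s g⟩
  map σ := ⟨f ◁ σ, σ ▷ g, by
    change (f ◁ σ) ▷ g ≫ (α_ f _ g).hom = (α_ f _ g).hom ≫ f ◁ (σ ▷ g)
    simp⟩
  map_id s := by
    apply Limits.CategoricalPullback.hom_ext <;> simp
  map_comp σ τ := by
    apply Limits.CategoricalPullback.hom_ext <;> simp

/-- `f` is left bi-orthogonal to `g`: the square of hom-categories with corners `C[b, c]`,
`C[a, c]`, `C[b, d]`, `C[a, d]` is a bipullback of categories. -/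
def BiOrth {a b c d : C} (f : a ⟶ b) (g : c ⟶ d) : Prop :=
  (orthComparison f g).IsEquivalence

/-- Bi-orthogonality in terms of fillers. -/
theorem biOrth_iff {a b c d : C} (f : a ⟶ b) (g : c ⟶ d) :
    BiOrth f g ↔
      (∀ (s t : b ⟶ c) (φ : f ≫ s ⟶ f ≫ t) (ψ : s ≫ g ⟶ t ≫ g),
        φ ▷ g ≫ (α_ f t g).hom = (α_ f s g).hom ≫ f ◁ ψ →
        ∃! σ : s ⟶ t, f ◁ σ = φ ∧ σ ▷ g = ψ) ∧
      (∀ (u : a ⟶ c) (v : b ⟶ d) (α : u ≫ g ≅ f ≫ v),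
        ∃ (s : b ⟶ c) (l : f ≫ s ≅ u) (r : s ≫ g ≅ v),
          l.hom ▷ g ≫ α.hom = (α_ f s g).hom ≫ f ◁ r.hom) := by
  constructor
  · intro h
    have h : (orthComparison f g).IsEquivalence := h
    refine ⟨fun s t φ ψ e => ?_, fun u v α => ?_⟩
    · obtain ⟨σ, hσ⟩ := (orthComparison f g).map_surjective
        (X := s) (Y := t) (⟨φ, ψ, e⟩ : (orthComparison f g).obj s ⟶ (orthComparison f g).obj t)
      refine ⟨σ, ⟨congrArg Limits.CategoricalPullback.Hom.fst hσ,
        congrArg Limits.CategoricalPullback.Hom.snd hσ⟩, fun τ hτ => ?_⟩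
      apply (orthComparison f g).map_injective
      rw [hσ]
      exact Limits.CategoricalPullback.hom_ext hτ.1 hτ.2
    · let X : Limits.CategoricalPullback (postcomp a g) (precomp d f) := ⟨u, v, α⟩
      let e := (orthComparison f g).objObjPreimageIso X
      exact ⟨(orthComparison f g).objPreimage X,
        (Limits.CategoricalPullback.π₁ _ _).mapIso e,
        (Limits.CategoricalPullback.π₂ _ _).mapIso e, e.hom.w⟩
  · rintro ⟨h₁, h₂⟩
    refine @Functor.IsEquivalence.mk _ _ _ _ _ ⟨?_⟩ ⟨?_⟩ ⟨?_⟩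
    · intro s t σ τ e
      obtain ⟨_, _, hu⟩ := h₁ s t (f ◁ τ) (τ ▷ g) (by simp)
      rw [hu σ ⟨congrArg Limits.CategoricalPullback.Hom.fst e,
        congrArg Limits.CategoricalPullback.Hom.snd e⟩, hu τ ⟨rfl, rfl⟩]
    · intro s t φ
      obtain ⟨σ, hσ, _⟩ := h₁ s t φ.fst φ.snd φ.w
      exact ⟨σ, Limits.CategoricalPullback.hom_ext hσ.1 hσ.2⟩
    · intro X
      obtain ⟨s, l, r, e⟩ := h₂ X.fst X.snd X.iso
      exact ⟨s, ⟨Limits.CategoricalPullback.mkIso l r e⟩⟩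

theorem biOrth_id (a : C) {c d : C} (g : c ⟶ d) : BiOrth (𝟙 a) g := by
  rw [biOrth_iff]
  refine ⟨fun s t φ ψ e => ?_, fun u v α => ?_⟩
  · have e' : ψ = (λ_ _).inv ≫ (α_ _ _ _).inv ≫ φ ▷ g ≫ (α_ _ _ _).hom ≫ (λ_ _).hom := by
      rw [reassoc_of% e]; simp
    refine ⟨(λ_ s).inv ≫ φ ≫ (λ_ t).hom, ⟨by simp, ?_⟩, fun τ hτ => ?_⟩
    · rw [e']; simp
    · rw [← hτ.1]; simp
  · exact ⟨u, λ_ u, α ≪≫ λ_ v, by simp⟩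

theorem biOrth_comp {a b b' c d : C} {f : a ⟶ b} {f' : b ⟶ b'} {g : c ⟶ d}
    (h : BiOrth f g) (h' : BiOrth f' g) : BiOrth (f ≫ f') g := by
  rw [biOrth_iff] at h h' ⊢
  obtain ⟨h₁, h₂⟩ := h
  obtain ⟨h₁', h₂'⟩ := h'
  refine ⟨fun s t φ ψ e => ?_, fun u v α => ?_⟩
  · have e' : φ ▷ g = (α_ _ _ _).hom ≫ (f ≫ f') ◁ ψ ≫ (α_ _ _ _).inv := by
      rw [← reassoc_of% e]; simp
    obtain ⟨σ₁, ⟨hσ₁, hσ₁'⟩, hu₁⟩ := h₁ (f' ≫ s) (f' ≫ t)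
      ((α_ f f' s).inv ≫ φ ≫ (α_ f f' t).hom)
      ((α_ f' s g).hom ≫ f' ◁ ψ ≫ (α_ f' t g).inv) (by
        simp only [comp_whiskerRight, e']
        bicategory)
    obtain ⟨σ, ⟨hσ, hσ'⟩, hu⟩ := h₁' s t σ₁ ψ (by rw [hσ₁']; simp)
    refine ⟨σ, ⟨?_, hσ'⟩, ?_⟩
    · rw [comp_whiskerLeft, hσ, hσ₁]; simp
    · rintro τ ⟨hτ, hτ'⟩
      refine hu τ ⟨hu₁ _ ⟨?_, ?_⟩, hτ'⟩
      · rw [← hτ]; simp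
      · rw [← hτ']; simp
  · obtain ⟨s₁, l₁, r₁, e₁⟩ := h₂ u (f' ≫ v) (α ≪≫ α_ f f' v)
    obtain ⟨s, l, r, e⟩ := h₂' s₁ v r₁
    refine ⟨s, α_ f f' s ≪≫ whiskerLeftIso f l ≪≫ l₁, r, ?_⟩
    have e₁' : l₁.hom ▷ g ≫ α.hom =
        (α_ f s₁ g).hom ≫ f ◁ r₁.hom ≫ (α_ f f' v).inv := by
      rw [← reassoc_of% e₁]; simp
    have e' : r₁.hom = l.inv ▷ g ≫ (α_ f' s g).hom ≫ f' ◁ r.hom := by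
      rw [← e, ← comp_whiskerRight_assoc]; simp
    simp only [Iso.trans_hom, whiskerLeftIso_hom, comp_whiskerRight, Category.assoc, e₁', e']
    have : f ◁ l.hom ▷ g ≫ f ◁ l.inv ▷ g = 𝟙 _ := by
      rw [← whiskerLeft_comp, ← comp_whiskerRight]; simp
    simp only [whisker_assoc, Category.assoc, Iso.inv_hom_id_assoc, whiskerLeft_comp,
      reassoc_of% this]
    bicategory

end Orthogonality

section Bifactorization

variable {C : Type u} [Bicategory.{w, v} C]

/-- A comparison from a factorization `θ' : l' ≫ r' ≅ f` to a factorization `θ : l ≫ r ≅ f`: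
an equivalence `i` between the middle objects and invertible 2-cells `l' ≫ i ≅ l`,
`r' ≅ i ≫ r` which paste with `θ` to `θ'`. -/
structure FactComparison {a b m m' : C} {f : a ⟶ b} {l' : a ⟶ m'} {r' : m' ⟶ b} {l : a ⟶ m}
    {r : m ⟶ b} (θ' : l' ≫ r' ≅ f) (θ : l ≫ r ≅ f) where
  equiv : m' ≌ m
  left : l' ≫ equiv.hom ≅ l
  right : r' ≅ equiv.hom ≫ r
  fac : θ'.hom = l' ◁ right.hom ≫ (α_ _ _ _).inv ≫ left.hom ▷ r ≫ θ.hom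

/-- Bifactorization systems: a bi-orthogonality structure `(L, R)` (each class is the orthogonal of
the other) such that every 1-cell has an `(L, R)`-factorization up to an invertible 2-cell, to
which every other `(L, R)`-factorization compares through an equivalence that is unique up to a
unique invertible 2-cell. -/
structure IsBifactorizationSystem (L R : MorphismProperty C) : Prop where
  left_iff : ∀ {a b : C} (f : a ⟶ b), L f ↔ ∀ {c d : C} (g : c ⟶ d), R g → BiOrth f g
  right_iff : ∀ {c d : C} (g : c ⟶ d), R g ↔ ∀ {a b : C} (f : a ⟶ b), L f → BiOrth f g
  exists_fac : ∀ {a b : C} (f : a ⟶ b),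
    ∃ (m : C) (l : a ⟶ m) (r : m ⟶ b) (θ : l ≫ r ≅ f), L l ∧ R r ∧
      ∀ (m' : C) (l' : a ⟶ m') (r' : m' ⟶ b) (θ' : l' ≫ r' ≅ f), L l' → R r' →
        ∃ i : FactComparison θ' θ, ∀ j : FactComparison θ' θ,
          ∃! σ : i.equiv.hom ≅ j.equiv.hom,
            l' ◁ σ.hom ≫ j.left.hom = i.left.hom ∧ i.right.hom ≫ σ.hom ▷ r = j.right.hom

theorem IsBifactorizationSystem.left_id {L R : MorphismProperty C}
    (h : IsBifactorizationSystem L R) (a : C) : L (𝟙 a) :=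
  (h.left_iff _).2 fun g _ => biOrth_id a g

theorem IsBifactorizationSystem.left_comp {L R : MorphismProperty C}
    (h : IsBifactorizationSystem L R) {a b c : C} (f : a ⟶ b) (g : b ⟶ c) (hf : L f) (hg : L g) :
    L (f ≫ g) :=
  (h.left_iff _).2 fun k hk => biOrth_comp ((h.left_iff f).1 hf k hk) ((h.left_iff g).1 hg k hk)

/-- `t` is biterminal: every hom-category into `t` is equivalent to the terminal category. -/
def IsBiterminal (t : C) : Prop :=
  ∀ a : C, (Functor.star.{0} (a ⟶ t)).IsEquivalence

end Bifactorization

/-- The 0-cells of the pseudoslice of `C` over `c`. -/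
structure PseudoSlice {C : Type u} [Bicategory.{w, v} C] (c : C) where
  left : C
  hom : left ⟶ c

namespace PseudoSlice

variable {C : Type u} [Bicategory.{w, v} C] {c : C}

/-- The 1-cells of the pseudoslice: triangles filled with an invertible 2-cell. -/
structure Hom (X Y : PseudoSlice c) where
  left : X.left ⟶ Y.left
  iso : left ≫ Y.hom ≅ X.hom

instance : CategoryStruct (PseudoSlice c) where
  Hom X Y := Hom X Y
  id X := ⟨𝟙 X.left, λ_ X.hom⟩
  comp f g := ⟨f.left ≫ g.left, α_ _ _ _ ≪≫ whiskerLeftIso f.left g.iso ≪≫ f.iso⟩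

@[simp]
theorem id_left (X : PseudoSlice c) : Hom.left (𝟙 X) = 𝟙 X.left := rfl

@[simp]
theorem id_iso (X : PseudoSlice c) : Hom.iso (𝟙 X) = λ_ X.hom := rfl

@[simp]
theorem comp_left {X Y Z : PseudoSlice c} (f : X ⟶ Y) (g : Y ⟶ Z) :
    Hom.left (f ≫ g) = f.left ≫ g.left := rfl

@[simp]
theorem comp_iso {X Y Z : PseudoSlice c} (f : X ⟶ Y) (g : Y ⟶ Z) :
    Hom.iso (f ≫ g) = α_ _ _ _ ≪≫ whiskerLeftIso f.left g.iso ≪≫ f.iso := rfl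

/-- The 2-cells of the pseudoslice: 2-cells of `C` compatible with the triangles. -/
@[ext]
structure Hom₂ {X Y : PseudoSlice c} (f g : X ⟶ Y) where
  left : f.left ⟶ g.left
  w : left ▷ Y.hom ≫ g.iso.hom = f.iso.hom

instance homCategory (X Y : PseudoSlice c) : Category (X ⟶ Y) where
  Hom f g := Hom₂ f g
  id f := ⟨𝟙 f.left, by simp⟩
  comp φ ψ := ⟨φ.left ≫ ψ.left, by rw [comp_whiskerRight, Category.assoc, ψ.w, φ.w]⟩
  id_comp φ := Hom₂.ext (Category.id_comp _)
  comp_id φ := Hom₂.ext (Category.comp_id _)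
  assoc φ ψ χ := Hom₂.ext (Category.assoc _ _ _)

@[ext]
theorem hom₂_ext {X Y : PseudoSlice c} {f g : X ⟶ Y} {φ ψ : f ⟶ g} (h : φ.left = ψ.left) :
    φ = ψ :=
  Hom₂.ext h

@[simp]
theorem id₂_left {X Y : PseudoSlice c} (f : X ⟶ Y) : Hom₂.left (𝟙 f) = 𝟙 f.left := rfl

@[simp]
theorem comp₂_left {X Y : PseudoSlice c} {f g h : X ⟶ Y} (φ : f ⟶ g) (ψ : g ⟶ h) :
    Hom₂.left (φ ≫ ψ) = φ.left ≫ ψ.left := rfl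

/-- Invertible 2-cells of the pseudoslice from compatible invertible 2-cells of `C`. -/
def isoMk {X Y : PseudoSlice c} {f g : X ⟶ Y} (φ : f.left ≅ g.left)
    (h : φ.hom ▷ Y.hom ≫ g.iso.hom = f.iso.hom) : f ≅ g where
  hom := ⟨φ.hom, h⟩
  inv := ⟨φ.inv, by rw [← h]; simp⟩
  hom_inv_id := Hom₂.ext φ.hom_inv_id
  inv_hom_id := Hom₂.ext φ.inv_hom_id

@[simp]
theorem isoMk_hom_left {X Y : PseudoSlice c} {f g : X ⟶ Y} (φ : f.left ≅ g.left)
    (h : φ.hom ▷ Y.hom ≫ g.iso.hom = f.iso.hom) : Hom₂.left (isoMk φ h).hom = φ.hom := rfl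

@[simp]
theorem isoMk_inv_left {X Y : PseudoSlice c} {f g : X ⟶ Y} (φ : f.left ≅ g.left)
    (h : φ.hom ▷ Y.hom ≫ g.iso.hom = f.iso.hom) : Hom₂.left (isoMk φ h).inv = φ.inv := rfl

instance bicategory : Bicategory (PseudoSlice c) where
  homCategory := homCategory
  whiskerLeft f g h φ := ⟨f.left ◁ φ.left, by
    simp [← φ.w]⟩
  whiskerRight {X Y Z f g} φ h := ⟨φ.left ▷ h.left, by
    simp [← φ.w, whisker_exchange_assoc]⟩
  associator f g h := isoMk (α_ f.left g.left h.left) (by simp)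
  leftUnitor f := isoMk (λ_ f.left) (by simp)
  rightUnitor f := isoMk (ρ_ f.left) (by simp)
  whiskerLeft_id f g := Hom₂.ext (whiskerLeft_id _ _)
  whiskerLeft_comp f _ _ _ φ ψ := Hom₂.ext (whiskerLeft_comp _ _ _)
  id_whiskerLeft φ := Hom₂.ext (id_whiskerLeft _)
  comp_whiskerLeft f g _ _ φ := Hom₂.ext (comp_whiskerLeft _ _ _)
  id_whiskerRight f g := Hom₂.ext (id_whiskerRight _ _)
  comp_whiskerRight φ ψ g := Hom₂.ext (comp_whiskerRight _ _ _)
  whiskerRight_id φ := Hom₂.ext (whiskerRight_id _)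
  whiskerRight_comp φ g h := Hom₂.ext (whiskerRight_comp _ _ _)
  whisker_assoc f _ _ φ g := Hom₂.ext (whisker_assoc _ _ _)
  whisker_exchange φ ψ := Hom₂.ext (whisker_exchange _ _)
  pentagon f g h i := Hom₂.ext (pentagon _ _ _ _)
  triangle f g := Hom₂.ext (triangle _ _)

end PseudoSlice

/-- A class of 0-cells and a class of 1-cells of a bicategory, the latter closed under identities
and composition. -/
structure SubBicat (B : Type u) [Bicategory.{w, v} B] where
  obj : B → Prop
  map : MorphismProperty B
  id_mem : ∀ a : B, map (𝟙 a)
  comp_mem : ∀ {a b c : B} (f : a ⟶ b) (g : b ⟶ c), map f → map g → map (f ≫ g)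

namespace SubBicat

variable {B : Type u} [Bicategory.{w, v} B]

/-- The 0-cells of the sub-bicategory: those in the given class. -/
structure Obj (S : SubBicat B) where
  obj : B
  mem : S.obj obj

variable {S : SubBicat B}

/-- The 1-cells of the sub-bicategory: those in the given class. -/
structure Hom (X Y : S.Obj) where
  hom : X.obj ⟶ Y.obj
  mem : S.map hom

instance : CategoryStruct S.Obj where
  Hom X Y := Hom X Y
  id X := ⟨𝟙 X.obj, S.id_mem _⟩
  comp f g := ⟨f.hom ≫ g.hom, S.comp_mem _ _ f.mem g.mem⟩

@[simp]
theorem id_hom (X : S.Obj) : Hom.hom (𝟙 X) = 𝟙 X.obj := rfl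

@[simp]
theorem comp_hom {X Y Z : S.Obj} (f : X ⟶ Y) (g : Y ⟶ Z) :
    Hom.hom (f ≫ g) = f.hom ≫ g.hom := rfl

/-- The 2-cells of the sub-bicategory: all 2-cells between 1-cells in the given class. -/
@[ext]
structure Hom₂ {X Y : S.Obj} (f g : X ⟶ Y) where
  hom : f.hom ⟶ g.hom

instance homCategory (X Y : S.Obj) : Category (X ⟶ Y) where
  Hom f g := Hom₂ f g
  id f := ⟨𝟙 f.hom⟩
  comp φ ψ := ⟨φ.hom ≫ ψ.hom⟩
  id_comp _ := Hom₂.ext (Category.id_comp _)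
  comp_id _ := Hom₂.ext (Category.comp_id _)
  assoc _ _ _ := Hom₂.ext (Category.assoc _ _ _)

@[ext]
theorem hom₂_ext {X Y : S.Obj} {f g : X ⟶ Y} {φ ψ : f ⟶ g} (h : φ.hom = ψ.hom) : φ = ψ :=
  Hom₂.ext h

@[simp]
theorem id₂_hom {X Y : S.Obj} (f : X ⟶ Y) : Hom₂.hom (𝟙 f) = 𝟙 f.hom := rfl

@[simp]
theorem comp₂_hom {X Y : S.Obj} {f g h : X ⟶ Y} (φ : f ⟶ g) (ψ : g ⟶ h) :
    Hom₂.hom (φ ≫ ψ) = φ.hom ≫ ψ.hom := rfl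

/-- Invertible 2-cells of the sub-bicategory from invertible 2-cells of the ambient one. -/
def isoMk {X Y : S.Obj} {f g : X ⟶ Y} (φ : f.hom ≅ g.hom) : f ≅ g where
  hom := ⟨φ.hom⟩
  inv := ⟨φ.inv⟩
  hom_inv_id := Hom₂.ext φ.hom_inv_id
  inv_hom_id := Hom₂.ext φ.inv_hom_id

@[simp]
theorem isoMk_hom_hom {X Y : S.Obj} {f g : X ⟶ Y} (φ : f.hom ≅ g.hom) :
    Hom₂.hom (isoMk φ).hom = φ.hom := rfl

@[simp]
theorem isoMk_inv_hom {X Y : S.Obj} {f g : X ⟶ Y} (φ : f.hom ≅ g.hom) :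
    Hom₂.hom (isoMk φ).inv = φ.inv := rfl

instance bicategory : Bicategory S.Obj where
  homCategory := homCategory
  whiskerLeft f _ _ φ := ⟨f.hom ◁ φ.hom⟩
  whiskerRight φ h := ⟨φ.hom ▷ h.hom⟩
  associator f g h := isoMk (α_ f.hom g.hom h.hom)
  leftUnitor f := isoMk (λ_ f.hom)
  rightUnitor f := isoMk (ρ_ f.hom)
  whiskerLeft_id _ _ := Hom₂.ext (whiskerLeft_id _ _)
  whiskerLeft_comp _ _ _ _ _ _ := Hom₂.ext (whiskerLeft_comp _ _ _)
  id_whiskerLeft _ := Hom₂.ext (id_whiskerLeft _)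
  comp_whiskerLeft _ _ _ _ _ := Hom₂.ext (comp_whiskerLeft _ _ _)
  id_whiskerRight _ _ := Hom₂.ext (id_whiskerRight _ _)
  comp_whiskerRight _ _ _ := Hom₂.ext (comp_whiskerRight _ _ _)
  whiskerRight_id _ := Hom₂.ext (whiskerRight_id _)
  whiskerRight_comp _ _ _ := Hom₂.ext (whiskerRight_comp _ _ _)
  whisker_assoc _ _ _ _ _ := Hom₂.ext (whisker_assoc _ _ _)
  whisker_exchange _ _ := Hom₂.ext (whisker_exchange _ _)
  pentagon _ _ _ _ := Hom₂.ext (pentagon _ _ _ _)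
  triangle _ _ := Hom₂.ext (triangle _ _)

/-- The inclusion of the sub-bicategory in the ambient bicategory. -/
def inclusion (S : SubBicat B) : S.Obj ⥤ᵖ B where
  obj X := X.obj
  map f := f.hom
  map₂ φ := φ.hom
  map₂_id _ := rfl
  map₂_comp _ _ := rfl
  mapId _ := Iso.refl _
  mapComp _ _ := Iso.refl _
  map₂_whisker_left f _ _ φ := by
    change f.hom ◁ φ.hom = 𝟙 _ ≫ f.hom ◁ φ.hom ≫ 𝟙 _
    simp
  map₂_whisker_right φ h := by
    change φ.hom ▷ h.hom = 𝟙 _ ≫ φ.hom ▷ h.hom ≫ 𝟙 _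
    simp
  map₂_associator f g h := by
    change (α_ f.hom g.hom h.hom).hom = 𝟙 _ ≫ 𝟙 (f.hom ≫ g.hom) ▷ h.hom ≫ (α_ _ _ _).hom ≫
      f.hom ◁ 𝟙 (g.hom ≫ h.hom) ≫ 𝟙 _
    simp
  map₂_left_unitor {X Y} f := by
    change (λ_ f.hom).hom = 𝟙 _ ≫ 𝟙 (𝟙 X.obj) ▷ f.hom ≫ (λ_ f.hom).hom
    simp
  map₂_right_unitor {X Y} f := by
    change (ρ_ f.hom).hom = 𝟙 _ ≫ f.hom ◁ 𝟙 (𝟙 Y.obj) ≫ (ρ_ f.hom).hom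
    simp

end SubBicat

section Bistable

variable {A : Type u₁} [Bicategory.{w₁, v₁} A] {B : Type u₂} [Bicategory.{w₂, v₂} B]

/-- The pseudofunctor between the 1-cell duals induced by a pseudofunctor. -/
def opPseudofunctor (U : A ⥤ᵖ B) : Aᵒᵖ ⥤ᵖ Bᵒᵖ where
  obj X := op (U.obj X.unop)
  map f := (U.map f.unop).op
  map₂ φ := op2 (U.map₂ φ.unop2)
  map₂_id f := congrArg op2 (U.map₂_id f.unop)
  map₂_comp φ ψ := congrArg op2 (U.map₂_comp φ.unop2 ψ.unop2)
  mapId X := (U.mapId X.unop).op2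
  mapComp f g := (U.mapComp g.unop f.unop).op2
  map₂_whisker_left f _ _ φ := congrArg op2 (U.map₂_whisker_right φ.unop2 f.unop)
  map₂_whisker_right φ h := congrArg op2 (U.map₂_whisker_left h.unop φ.unop2)
  map₂_associator f g h := congrArg op2 (by
    change U.map₂ (α_ h.unop g.unop f.unop).inv =
      (U.mapComp h.unop (g.unop ≫ f.unop)).hom ≫
        U.map h.unop ◁ (U.mapComp g.unop f.unop).hom ≫
          (α_ (U.map h.unop) (U.map g.unop) (U.map f.unop)).inv ≫
            (U.mapComp h.unop g.unop).inv ▷ U.map f.unop ≫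
              (U.mapComp (h.unop ≫ g.unop) f.unop).inv
    rw [U.mapComp_assoc_right_hom_assoc]
    simp)
  map₂_left_unitor f := congrArg op2 (U.map₂_right_unitor f.unop)
  map₂_right_unitor f := congrArg op2 (U.map₂_left_unitor f.unop)

variable (U : A ⥤ᵖ B)

/-- A diagonal of the pseudosquare `α : f ≫ U u ≅ n ≫ U v`: a 1-cell `w` of `A` with invertible
2-cells `ν` in `B` and `ω` in `A` whose pasting, after applying `U` to `ω`, is `α`. -/
structure Diagonal {b : B} {a a₁ a₂ : A} {n : b ⟶ U.obj a} {f : b ⟶ U.obj a₁} {u : a₁ ⟶ a₂}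
    {v : a ⟶ a₂} (α : f ≫ U.map u ≅ n ≫ U.map v) where
  w : a ⟶ a₁
  ν : f ≅ n ≫ U.map w
  ω : w ≫ u ≅ v
  fac : α.hom = ν.hom ▷ U.map u ≫ (α_ _ _ _).hom ≫ n ◁ (U.mapComp w u).inv ≫ n ◁ U.map₂ ω.hom

variable {U}

/-- `σ` is a 2-cell between diagonals over the 2-cell `φ` between the upper sides. -/
def Diagonal.Compatible {b : B} {a a₁ a₂ : A} {n : b ⟶ U.obj a} {u : a₁ ⟶ a₂} {v : a ⟶ a₂}
    {f f' : b ⟶ U.obj a₁} {α : f ≫ U.map u ≅ n ≫ U.map v} {α' : f' ≫ U.map u ≅ n ≫ U.map v}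
    (φ : f ⟶ f') (D : Diagonal U α) (D' : Diagonal U α') (σ : D.w ⟶ D'.w) : Prop :=
  D.ω.hom = σ ▷ u ≫ D'.ω.hom ∧ φ ≫ D'.ν.hom = D.ν.hom ≫ n ◁ U.map₂ σ

variable (U)

/-- `U`-generic morphisms. -/
structure IsGeneric {b : B} {a : A} (n : b ⟶ U.obj a) : Prop where
  /-- Every pseudosquare has a diagonal, unique up to a unique invertible 2-cell. -/
  exists_diagonal : ∀ {a₁ a₂ : A} (u : a₁ ⟶ a₂) (v : a ⟶ a₂) (f : b ⟶ U.obj a₁)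
    (α : f ≫ U.map u ≅ n ≫ U.map v),
    ∃ D : Diagonal U α, ∀ D' : Diagonal U α,
      ∃! σ : D.w ≅ D'.w, Diagonal.Compatible (𝟙 f) D D' σ.hom
  /-- A morphism of pseudosquares with the same lower side induces a unique 2-cell between the
  diagonals. -/
  exists_unique_cell : ∀ {a₁ a₂ : A} (u : a₁ ⟶ a₂) (v : a ⟶ a₂) (f f' : b ⟶ U.obj a₁)
    (α : f ≫ U.map u ≅ n ≫ U.map v) (α' : f' ≫ U.map u ≅ n ≫ U.map v) (φ : f ⟶ f'),
    φ ▷ U.map u ≫ α'.hom = α.hom →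
    ∀ (D : Diagonal U α) (D' : Diagonal U α'),
      ∃! σ : D.w ⟶ D'.w, Diagonal.Compatible φ D D' σ

/-- `U` is bistable: every `f : b ⟶ U a` factors up to an invertible 2-cell as a generic morphism
`n` followed by some `U u`, and any other such factorization `(n', u')` compares to it through an
equivalence `e` with `n' ≫ U e ≅ n` and `e ≫ u ≅ u'`, unique up to a unique invertible 2-cell. -/
def IsBistable : Prop :=
  ∀ {b : B} {a : A} (f : b ⟶ U.obj a),
    ∃ (m : A) (n : b ⟶ U.obj m) (u : m ⟶ a) (θ : n ≫ U.map u ≅ f), IsGeneric U n ∧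
      ∀ (m' : A) (n' : b ⟶ U.obj m') (u' : m' ⟶ a) (θ' : n' ≫ U.map u' ≅ f), IsGeneric U n' →
        ∃ D : Diagonal U (θ ≪≫ θ'.symm), (∃ e : m' ≌ m, e.hom = D.w) ∧
          ∀ D' : Diagonal U (θ ≪≫ θ'.symm),
            ∃! σ : D.w ≅ D'.w, Diagonal.Compatible (𝟙 n) D D' σ.hom

end Bistable

section LeftObjects

variable {C : Type u} [Bicategory.{w, v} C] {L R : MorphismProperty C}

/-- Left objects (those with a terminal map in `L`), and `L`-maps between them. -/
def leftObj (h : IsBifactorizationSystem L R) (t : C) : SubBicat C where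
  obj a := ∃ p : a ⟶ t, L p
  map := L
  id_mem := h.left_id
  comp_mem := h.left_comp

/-- Left objects over `c`: the sub-bicategory of the pseudoslice over `c` on the 0-cells in `L`
and the triangles whose upper side is in `L`. -/
def leftObjOver (h : IsBifactorizationSystem L R) (c : C) : SubBicat (PseudoSlice c) where
  obj X := L X.hom
  map _ _ f := L f.left
  id_mem X := h.left_id X.left
  comp_mem f g := h.left_comp f.left g.left

end LeftObjects

end BistableInclusion

open BistableInclusion

/-! Written in the bicategory itself, a pseudosquare for the opposite of an inclusion is an
invertible 2-cell `u ≫ f ≅ v ≫ r` with `u`, `v` in the left class: a lifting problem of `u` against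
`r`, with top `v` and bottom `f`. A diagonal is a filler `s`, with `u ≫ s ≅ v` and `s ≫ r ≅ f`,
which itself lies in the left class. If `r` is in `R`, orthogonality supplies `s`, and `u ≫ s ≅ v`
puts it in the left class, because a left orthogonal class is right cancellable (`BiOrth.of_comp`).
Full faithfulness of the comparison functor supplies the 2-cells. So right maps are generic
(`IsLeftPart.isGeneric`).

An `(L, R)`-factorization of a map out of a left object passes through a left object, again by right
cancellation, so it is a generic factorization. Two generic factorizations of one map compare by an
equivalence, since the diagonals in the two directions are mutually quasi-inverse
(`IsGeneric.exists_equivalence`). This gives bistability. It also gives the converse on generics: a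
generic `r` agrees, up to an equivalence, with its own right part, and `R` absorbs equivalences.

The argument uses only the four properties collected in `SubBicat.IsLeftPart`, so both halves of the
theorem follow by verifying these for left objects and for left objects over `c`. -/

namespace BistableInclusion

/-! ### Closure properties of bi-orthogonality. -/

section Orthogonality

variable {C : Type u} [Bicategory.{w, v} C]

/-- Whiskering on the right with a 1-cell that has a quasi-inverse is an equivalence. -/
theorem postcomp_isEquivalence (a : C) {c d : C} {e : c ⟶ d} {e' : d ⟶ c} (η : 𝟙 c ≅ e ≫ e')
    (κ : e' ≫ e ≅ 𝟙 d) : (postcomp a e).IsEquivalence :=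
  (CategoryTheory.Equivalence.mk (postcomp a e) (postcomp a e')
    (NatIso.ofComponents (fun s => (ρ_ s).symm ≪≫ whiskerLeftIso s η ≪≫ (α_ s e e').symm)
      (fun {s t} σ => by
        have : s ◁ η.hom ≫ (α_ s e e').inv ≫ σ ▷ e ▷ e' =
            (ρ_ s).hom ≫ σ ≫ (ρ_ t).inv ≫ t ◁ η.hom ≫ (α_ t e e').inv :=
          (cancel_mono (α_ t e e').hom).1 (by simpa using whisker_exchange σ η.hom)
        simp [postcomp, this]))
    (NatIso.ofComponents (fun s => α_ s e' e ≪≫ whiskerLeftIso s κ ≪≫ ρ_ s)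
      (fun {s t} σ => by
        have : σ ▷ e' ▷ e ≫ (α_ t e' e).hom ≫ t ◁ κ.hom =
            (α_ s e' e).hom ≫ s ◁ κ.hom ≫ (ρ_ s).hom ≫ σ ≫ (ρ_ t).inv :=
          (cancel_epi (α_ s e' e).inv).1 (by simpa using (whisker_exchange σ κ.hom).symm)
        simp [postcomp, reassoc_of% this]))).isEquivalence_functor

/-- A morphism of pseudosquares with invertible components between squares that have a diagonal
comes from an invertible 2-cell. -/
theorem BiOrth.exists_iso {a b c d : C} {f : a ⟶ b} {g : c ⟶ d} (h : BiOrth f g) {s t : b ⟶ c}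
    (φ : f ≫ s ≅ f ≫ t) (ψ : s ≫ g ≅ t ≫ g)
    (e : φ.hom ▷ g ≫ (α_ f t g).hom = (α_ f s g).hom ≫ f ◁ ψ.hom) :
    ∃ σ : s ≅ t, f ◁ σ.hom = φ.hom ∧ σ.hom ▷ g = ψ.hom := by
  have h : (orthComparison f g).IsEquivalence := h
  let θ : (orthComparison f g).obj s ≅ (orthComparison f g).obj t :=
    Limits.CategoricalPullback.mkIso φ ψ e
  have hθ : (orthComparison f g).map ((orthComparison f g).preimageIso θ).hom = θ.hom := by simp
  exact ⟨(orthComparison f g).preimageIso θ, congrArg Limits.CategoricalPullback.Hom.fst hθ,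
    congrArg Limits.CategoricalPullback.Hom.snd hθ⟩

theorem BiOrth.cell_ext {a b c d : C} {f : a ⟶ b} {g : c ⟶ d} (h : BiOrth f g) {s t : b ⟶ c}
    {σ τ : s ⟶ t} (e₁ : f ◁ σ = f ◁ τ) (e₂ : σ ▷ g = τ ▷ g) : σ = τ := by
  have h : (orthComparison f g).IsEquivalence := h
  exact (orthComparison f g).map_injective (Limits.CategoricalPullback.hom_ext e₁ e₂)

theorem BiOrth.of_iso_left {a b c d : C} {f f' : a ⟶ b} {g : c ⟶ d} (h : BiOrth f g)
    (i : f ≅ f') : BiOrth f' g := by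
  rw [biOrth_iff] at h ⊢
  obtain ⟨h₁, h₂⟩ := h
  refine ⟨fun s t φ ψ e => ?_, fun u v α => ?_⟩
  · have e' : φ ▷ g = (α_ _ _ _).hom ≫ f' ◁ ψ ≫ (α_ _ _ _).inv := by
      rw [← reassoc_of% e]; simp
    obtain ⟨σ, ⟨hσ, hσ'⟩, hu⟩ := h₁ s t (i.hom ▷ s ≫ φ ≫ i.inv ▷ t) ψ (by
      have : f' ◁ ψ = i.inv ▷ (s ≫ g) ≫ f ◁ ψ ≫ i.hom ▷ (t ≫ g) := by
        rw [whisker_exchange]; simp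
      simp [e', this])
    refine ⟨σ, ⟨?_, hσ'⟩, fun τ hτ => hu τ ⟨?_, hτ.2⟩⟩
    · have := whisker_exchange i.inv σ
      rw [hσ] at this
      exact (cancel_epi (i.hom ▷ s)).1 ((cancel_mono (i.inv ▷ t)).1 (by simp [this]))
    · have := whisker_exchange i.hom τ
      rw [← hτ.1, ← reassoc_of% this]
      simp [← comp_whiskerRight]
  · obtain ⟨s, l, r, e⟩ := h₂ u v (α ≪≫ whiskerRightIso i.symm v)
    refine ⟨s, whiskerRightIso i.symm s ≪≫ l, r, ?_⟩
    have e' : l.hom ▷ g ≫ α.hom = (α_ f s g).hom ≫ f ◁ r.hom ≫ i.hom ▷ v := by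
      rw [← reassoc_of% e]
      simp [← comp_whiskerRight]
    have := whisker_exchange i.hom r.hom
    simp [e', this, ← comp_whiskerRight_assoc]

theorem BiOrth.of_iso_right {a b c d : C} {f : a ⟶ b} {g g' : c ⟶ d} (h : BiOrth f g)
    (i : g ≅ g') : BiOrth f g' := by
  rw [biOrth_iff] at h ⊢
  obtain ⟨h₁, h₂⟩ := h
  refine ⟨fun s t φ ψ e => ?_, fun u v α => ?_⟩
  · have e' : f ◁ ψ = (α_ _ _ _).inv ≫ φ ▷ g' ≫ (α_ _ _ _).hom := by
      rw [e]; simp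
    have e'' : φ ▷ g' = (f ≫ s) ◁ i.inv ≫ φ ▷ g ≫ (f ≫ t) ◁ i.hom := by
      rw [← whisker_exchange]; simp
    obtain ⟨σ, ⟨hσ, hσ'⟩, hu⟩ := h₁ s t φ (s ◁ i.hom ≫ ψ ≫ t ◁ i.inv) (by
      simp [e', e''])
    refine ⟨σ, ⟨hσ, ?_⟩, fun τ hτ => hu τ ⟨hτ.1, ?_⟩⟩
    · have := whisker_exchange σ i.inv
      rw [hσ'] at this
      exact (cancel_mono (t ◁ i.inv)).1 (by simp [← this])
    · have := whisker_exchange τ i.hom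
      rw [← hτ.2, reassoc_of% this]
      simp [← whiskerLeft_comp]
  · obtain ⟨s, l, r, e⟩ := h₂ u v (whiskerLeftIso u i ≪≫ α)
    refine ⟨s, l, whiskerLeftIso s i.symm ≪≫ r, ?_⟩
    have e' : f ◁ r.hom = (α_ f s g).inv ≫ l.hom ▷ g ≫ u ◁ i.hom ≫ α.hom := by
      simpa using (congrArg ((α_ f s g).inv ≫ ·) e).symm
    have : l.hom ▷ g' = (f ≫ s) ◁ i.inv ≫ l.hom ▷ g ≫ u ◁ i.hom := by
      rw [← whisker_exchange]; simp
    simp [e', this]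

/-- Postcomposing with an equivalence is an equivalence on hom-categories, so the part of a filler
lying over the lower side determines everything else. -/
theorem biOrth_of_quasiInverse {a b c d : C} (f : a ⟶ b) {e : c ⟶ d} {e' : d ⟶ c}
    (η : 𝟙 c ≅ e ≫ e') (κ : e' ≫ e ≅ 𝟙 d) : BiOrth f e := by
  have hE (x : C) : (postcomp x e).IsEquivalence := postcomp_isEquivalence x η κ
  rw [biOrth_iff]
  refine ⟨fun s t φ ψ k => ?_, fun u v α => ?_⟩
  · obtain ⟨σ, hσ⟩ := (postcomp b e).map_surjective (X := s) (Y := t) ψ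
    have hσ : σ ▷ e = ψ := hσ
    -- `σ` is chosen to induce `ψ`; that it also induces `φ` is tested after whiskering with `e`,
    -- where it becomes the hypothesis `k`.
    refine ⟨σ, ⟨(postcomp a e).map_injective ?_, hσ⟩, fun τ hτ =>
      (postcomp b e).map_injective (hτ.2.trans hσ.symm)⟩
    change (f ◁ σ) ▷ e = φ ▷ e
    rw [← cancel_mono (α_ f t e).hom, k]
    simp [hσ]
  · let r : (v ≫ e') ≫ e ≅ v := α_ _ _ _ ≪≫ whiskerLeftIso v κ ≪≫ ρ_ v
    let θ : (postcomp a e).obj (f ≫ v ≫ e') ≅ (postcomp a e).obj u :=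
      α_ f (v ≫ e') e ≪≫ whiskerLeftIso f r ≪≫ α.symm
    have hθ : ((postcomp a e).preimageIso θ).hom ▷ e = θ.hom :=
      (postcomp a e).map_preimage θ.hom
    refine ⟨v ≫ e', (postcomp a e).preimageIso θ, r, ?_⟩
    rw [hθ]
    change ((α_ f (v ≫ e') e).hom ≫ f ◁ r.hom ≫ α.inv) ≫ α.hom = _
    simp

/-- Lift against `g'` first and feed the result to `g` as a lower side. With an equivalence as first
factor, this is what makes right classes stable under precomposition with equivalences. -/
theorem biOrth_comp_right {a b c d d' : C} {f : a ⟶ b} {g : c ⟶ d} {g' : d ⟶ d'}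
    (h : BiOrth f g) (h' : BiOrth f g') : BiOrth f (g ≫ g') := by
  rw [biOrth_iff] at h h' ⊢
  obtain ⟨h₁, h₂⟩ := h
  obtain ⟨h₁', h₂'⟩ := h'
  refine ⟨fun s t φ ψ e => ?_, fun u v α => ?_⟩
  · have e' : f ◁ ψ = (α_ _ _ _).inv ≫ φ ▷ (g ≫ g') ≫ (α_ _ _ _).hom := by
      rw [e]; simp
    obtain ⟨σ₁, ⟨hσ₁, hσ₁'⟩, hu₁⟩ := h₁' (s ≫ g) (t ≫ g)
      ((α_ f s g).inv ≫ φ ▷ g ≫ (α_ f t g).hom)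
      ((α_ s g g').hom ≫ ψ ≫ (α_ t g g').inv) (by
        simp only [whiskerLeft_comp, e']
        bicategory)
    obtain ⟨σ, ⟨hσ, hσ'⟩, hu⟩ := h₁ s t φ σ₁ (by rw [hσ₁]; simp)
    refine ⟨σ, ⟨hσ, ?_⟩, ?_⟩
    · rw [whiskerRight_comp, hσ', hσ₁']; simp
    · rintro τ ⟨hτ, hτ'⟩
      refine hu τ ⟨hτ, hu₁ _ ⟨?_, ?_⟩⟩
      · rw [← hτ]; simp
      · rw [← hτ']; simp
  · obtain ⟨s₁, l₁, r₁, e₁⟩ := h₂' (u ≫ g) v (α_ u g g' ≪≫ α)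
    obtain ⟨s, l, r, e⟩ := h₂ u s₁ l₁.symm
    refine ⟨s, l, (α_ s g g').symm ≪≫ whiskerRightIso r g' ≪≫ r₁, ?_⟩
    have e₁' : f ◁ r₁.hom = (α_ f s₁ g').inv ≫ l₁.hom ▷ g' ≫ (α_ u g g').hom ≫ α.hom := by
      simpa using (congrArg ((α_ f s₁ g').inv ≫ ·) e₁).symm
    have e' : l.hom ▷ g = (α_ f s g).hom ≫ f ◁ r.hom ≫ l₁.hom := by
      rw [← reassoc_of% e]; simp
    rw [whiskerRight_comp, e']
    simp [e₁']

/-- The left orthogonal of a 1-cell is closed under right cancellation. -/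
theorem BiOrth.of_comp {a b b' c d : C} {f : a ⟶ b} {f' : b ⟶ b'} {g : c ⟶ d}
    (h : BiOrth f g) (h' : BiOrth (f ≫ f') g) : BiOrth f' g := by
  rw [biOrth_iff] at h' ⊢
  obtain ⟨h₁', h₂'⟩ := h'
  refine ⟨fun s t φ ψ e => ?_, fun u v α => ?_⟩
  · have e' : φ ▷ g = (α_ _ _ _).hom ≫ f' ◁ ψ ≫ (α_ _ _ _).inv := by
      rw [← reassoc_of% e]; simp
    obtain ⟨σ, ⟨hσ, hσ'⟩, hu⟩ := h₁' s t
      ((α_ f f' s).hom ≫ f ◁ φ ≫ (α_ f f' t).inv) ψ (by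
        have : (f ◁ φ) ▷ g = (α_ _ _ _).hom ≫ f ◁ (φ ▷ g) ≫ (α_ _ _ _).inv := by simp
        simp only [comp_whiskerRight, this, e']
        bicategory)
    -- The equality `f' ◁ σ = φ` is tested after whiskering with `f` and with `g`, which suffices
    -- because `f` is orthogonal to `g`.
    refine ⟨σ, ⟨h.cell_ext ?_ ?_, hσ'⟩, fun τ hτ => hu τ ⟨?_, hτ.2⟩⟩
    · have := congrArg (fun x => (α_ f f' s).inv ≫ x ≫ (α_ f f' t).hom) hσ
      simpa using this
    · rw [e', ← hσ']; simp
    · rw [← hτ.1]; simp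
  · obtain ⟨s, l, r, e⟩ := h₂' (f ≫ u) v
      (α_ f u g ≪≫ whiskerLeftIso f α ≪≫ (α_ f f' v).symm)
    -- The filler of the square whiskered by `f` only has `(f ≫ f') ≫ s ≅ f ≫ u`. Orthogonality of
    -- `f` descends this to `f' ≫ s ≅ u`, the part over `g` being prescribed by `r` and `α`.
    obtain ⟨σ, hσ, hσ'⟩ := h.exists_iso ((α_ f f' s).symm ≪≫ l)
      (α_ f' s g ≪≫ whiskerLeftIso f' r ≪≫ α.symm) (by
        have e' : l.hom ▷ g ≫ (α_ f u g).hom = (α_ (f ≫ f') s g).hom ≫ (f ≫ f') ◁ r.hom ≫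
            (α_ f f' v).hom ≫ f ◁ α.inv := by
          rw [← reassoc_of% e]; simp [← whiskerLeft_comp]
        simp [e'])
    exact ⟨s, σ, r, by rw [hσ']; simp⟩

end Orthogonality

/-! ### Stability of the two classes, and biterminal objects. -/

section Bifactorization

variable {C : Type u} [Bicategory.{w, v} C] {L R : MorphismProperty C}

theorem IsBifactorizationSystem.biOrth (h : IsBifactorizationSystem L R) {a b c d : C}
    {f : a ⟶ b} {g : c ⟶ d} (hf : L f) (hg : R g) : BiOrth f g :=
  (h.left_iff f).1 hf g hg

theorem IsBifactorizationSystem.left_of_iso (h : IsBifactorizationSystem L R) {a b : C}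
    {f f' : a ⟶ b} (i : f ≅ f') (hf : L f) : L f' :=
  (h.left_iff _).2 fun _ hg => (h.biOrth hf hg).of_iso_left i

theorem IsBifactorizationSystem.left_of_comp (h : IsBifactorizationSystem L R) {a b c : C}
    {f : a ⟶ b} {g : b ⟶ c} {k : a ⟶ c} (i : f ≫ g ≅ k) (hf : L f) (hk : L k) : L g :=
  (h.left_iff _).2 fun _ hr => (h.biOrth hf hr).of_comp (h.biOrth (h.left_of_iso i.symm hk) hr)

theorem IsBifactorizationSystem.right_of_quasiInverse (h : IsBifactorizationSystem L R)
    {a b c : C} {e : a ⟶ b} {e' : b ⟶ a} (η : 𝟙 a ≅ e ≫ e') (κ : e' ≫ e ≅ 𝟙 b) {r : b ⟶ c}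
    {k : a ⟶ c} (i : k ≅ e ≫ r) (hr : R r) : R k :=
  (h.right_iff _).2 fun f hf =>
    (biOrth_comp_right (biOrth_of_quasiInverse f η κ) (h.biOrth hf hr)).of_iso_right i.symm

theorem IsBiterminal.nonempty_iso {t : C} (ht : IsBiterminal t) {a : C} (p q : a ⟶ t) :
    Nonempty (p ≅ q) := by
  have := ht a
  exact ⟨(Functor.star.{0} (a ⟶ t)).preimageIso (Iso.refl _)⟩

theorem IsBiterminal.nonempty_hom {t : C} (ht : IsBiterminal t) (a : C) : Nonempty (a ⟶ t) := by
  have := ht a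
  exact ⟨(Functor.star.{0} (a ⟶ t)).objPreimage ⟨⟨⟩⟩⟩

end Bifactorization

/-! ### Calculus of diagonals and uniqueness of generic factorizations. -/

section Diagonals

variable {A : Type u₁} [Bicategory.{w₁, v₁} A] {B : Type u₂} [Bicategory.{w₂, v₂} B]
  (U : A ⥤ᵖ B)

/-- The identity diagonal of an identity pseudosquare. -/
def Diagonal.refl {b : B} {a a₂ : A} (n : b ⟶ U.obj a) (v : a ⟶ a₂) :
    Diagonal U (Iso.refl (n ≫ U.map v)) where
  w := 𝟙 a
  ν := (ρ_ n).symm ≪≫ whiskerLeftIso n (U.mapId a).symm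
  ω := λ_ v
  fac := by
    simp [Pseudofunctor.map₂_left_unitor]

variable {U}

/-- Composition of diagonals. -/
def Diagonal.comp {b : B} {a a₁ a₂ a₃ : A} {n : b ⟶ U.obj a} {f : b ⟶ U.obj a₁}
    {g : b ⟶ U.obj a₃} {z : a₃ ⟶ a₂} {u : a₁ ⟶ a₂} {v : a ⟶ a₂} {β : g ≫ U.map z ≅ f ≫ U.map u}
    {α : f ≫ U.map u ≅ n ≫ U.map v} (D' : Diagonal U β) (D : Diagonal U α) :
    Diagonal U (β ≪≫ α) where
  w := D.w ≫ D'.w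
  ν := D'.ν ≪≫ whiskerRightIso D.ν (U.map D'.w) ≪≫ α_ _ _ _ ≪≫
    whiskerLeftIso n (U.mapComp D.w D'.w).symm
  ω := α_ _ _ _ ≪≫ whiskerLeftIso D.w D'.ω ≪≫ D.ω
  fac := by
    -- Interchange moves the upper 2-cell of `D` past the lower 2-cell of `D'`, after which the
    -- pseudofunctor coherences identify the two pastings.
    have hx := whisker_exchange D.ν.hom ((U.mapComp D'.w z).inv ≫ U.map₂ D'.ω.hom)
    have e : (β ≪≫ α).hom = D'.ν.hom ▷ U.map z ≫ (α_ _ _ _).hom ≫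
        (D.ν.hom ▷ (U.map D'.w ≫ U.map z) ≫
          (n ≫ U.map D.w) ◁ ((U.mapComp D'.w z).inv ≫ U.map₂ D'.ω.hom)) ≫
        (α_ _ _ _).hom ≫ n ◁ (U.mapComp D.w u).inv ≫ n ◁ U.map₂ D.ω.hom := by
      rw [← hx, Iso.trans_hom, D'.fac, D.fac]
      simp only [whiskerLeft_comp, Category.assoc]
    rw [e]
    simp [Pseudofunctor.map₂_associator, Pseudofunctor.map₂_whisker_left]

theorem Diagonal.Compatible.refl {b : B} {a a₁ a₂ : A} {n : b ⟶ U.obj a} {f : b ⟶ U.obj a₁}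
    {u : a₁ ⟶ a₂} {v : a ⟶ a₂} {α : f ≫ U.map u ≅ n ≫ U.map v} (D : Diagonal U α) :
    Diagonal.Compatible (𝟙 f) D D (𝟙 D.w) :=
  ⟨by simp, by simp⟩

theorem Diagonal.Compatible.trans {b : B} {a a₁ a₂ : A} {n : b ⟶ U.obj a} {f : b ⟶ U.obj a₁}
    {u : a₁ ⟶ a₂} {v : a ⟶ a₂} {α : f ≫ U.map u ≅ n ≫ U.map v} {D D' D'' : Diagonal U α}
    {σ : D.w ⟶ D'.w} {τ : D'.w ⟶ D''.w} (hσ : Diagonal.Compatible (𝟙 f) D D' σ)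
    (hτ : Diagonal.Compatible (𝟙 f) D' D'' τ) : Diagonal.Compatible (𝟙 f) D D'' (σ ≫ τ) := by
  obtain ⟨h₁, h₂⟩ := hσ
  obtain ⟨h₃, h₄⟩ := hτ
  rw [Category.id_comp] at h₂ h₄
  refine ⟨by rw [h₁, h₃]; simp, by rw [Category.id_comp, h₄, h₂]; simp⟩

/-- Both diagonals compare with the one provided by genericity. Two squares with an equality between
them are allowed because a composite such as `α.symm ≪≫ α` equals the identity only propositionally.
-/
theorem IsGeneric.nonempty_iso {b : B} {a a₁ a₂ : A} {n : b ⟶ U.obj a} (hn : IsGeneric U n)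
    {f : b ⟶ U.obj a₁} {u : a₁ ⟶ a₂} {v : a ⟶ a₂} {α : f ≫ U.map u ≅ n ≫ U.map v}
    {α' : f ≫ U.map u ≅ n ≫ U.map v} (hα : α = α') (D : Diagonal U α) (D' : Diagonal U α') :
    Nonempty (D.w ≅ D'.w) := by
  subst hα
  obtain ⟨D₀, hD₀⟩ := hn.exists_diagonal u v f α
  obtain ⟨σ, -, -⟩ := hD₀ D
  obtain ⟨σ', -, -⟩ := hD₀ D'
  exact ⟨σ.symm ≪≫ σ'⟩

/-- The diagonal of a pseudosquare both of whose upper sides are generic is an equivalence. -/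
theorem IsGeneric.exists_equivalence {b : B} {a a₁ a₂ : A} {n : b ⟶ U.obj a}
    (hn : IsGeneric U n) {f : b ⟶ U.obj a₁} (hf : IsGeneric U f) {u : a₁ ⟶ a₂} {v : a ⟶ a₂}
    {α : f ≫ U.map u ≅ n ≫ U.map v} (D : Diagonal U α) : ∃ e : a ≌ a₁, e.hom = D.w := by
  obtain ⟨D', -⟩ := hf.exists_diagonal v u n α.symm
  -- The composite of the two diagonals and the identity are diagonals of the same identity square,
  -- hence isomorphic.
  obtain ⟨η⟩ := hn.nonempty_iso α.symm_self_id.symm (Diagonal.refl U n v) (D'.comp D)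
  obtain ⟨κ⟩ := hf.nonempty_iso α.self_symm_id (D.comp D') (Diagonal.refl U f u)
  exact ⟨Equivalence.mkOfAdjointifyCounit (f := D.w) (g := D'.w) η κ, rfl⟩

end Diagonals

/-! ### Generics and bistability for an abstract left part. -/

namespace SubBicat

variable {B : Type u} [Bicategory.{w, v} B]

/-- `S` is the left part of a factorization of the 1-cells out of the 0-cells of `S`, with right
part in `R`: the class `S.map` is left orthogonal to `R` and right cancellable, `R` is stable under
precomposition with equivalences, and 1-cells out of a 0-cell in `S` factor through a 0-cell
in `S`. -/
structure IsLeftPart (S : SubBicat B) (R : MorphismProperty B) : Prop where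
  biOrth : ∀ {a b c d : B} {f : a ⟶ b} {g : c ⟶ d}, S.map f → R g → BiOrth f g
  map_of_comp : ∀ {a b c : B} {f : a ⟶ b} {g : b ⟶ c} {k : a ⟶ c}, (f ≫ g ≅ k) →
    S.map f → S.map k → S.map g
  right_of_quasiInverse : ∀ {a b c : B} {e : a ⟶ b} {e' : b ⟶ a}, (𝟙 a ≅ e ≫ e') →
    (e' ≫ e ≅ 𝟙 b) → ∀ {r : b ⟶ c} {k : a ⟶ c}, (k ≅ e ≫ r) → R r → R k
  exists_fac : ∀ {a b : B} (f : a ⟶ b), S.obj a →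
    ∃ (m : B) (l : a ⟶ m) (r : m ⟶ b), S.obj m ∧ S.map l ∧ R r ∧ Nonempty (l ≫ r ≅ f)

variable {S : SubBicat B} {R : MorphismProperty B}

/-- The compatibility of diagonals for the opposite of the inclusion, in the ambient
bicategory. -/
theorem diagonal_fac {A A₁ A₂ : S.Obj} {b : B} {r : A.obj ⟶ b} {f : A₁.obj ⟶ b} {u : A₂ ⟶ A₁}
    {v : A₂ ⟶ A} {α : f.op ≫ (opPseudofunctor S.inclusion).map u.op ≅
      r.op ≫ (opPseudofunctor S.inclusion).map v.op}
    (D : Diagonal (opPseudofunctor S.inclusion) (a := op A) (a₁ := op A₁) (a₂ := op A₂)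
      (u := u.op) (v := v.op) α) :
    (show u.hom ≫ f ⟶ v.hom ≫ r from α.hom.unop2) =
      u.hom ◁ (show f ⟶ D.w.unop.hom ≫ r from D.ν.hom.unop2) ≫
      (α_ u.hom D.w.unop.hom r).inv ≫
      (show u.hom ≫ D.w.unop.hom ⟶ v.hom from D.ω.hom.unop2.hom) ▷ r := by
  have h := congrArg Hom2.unop2 D.fac
  refine h.trans ?_
  change u.hom ◁ (show f ⟶ D.w.unop.hom ≫ r from D.ν.hom.unop2) ≫
      (α_ u.hom D.w.unop.hom r).inv ≫ (𝟙 (u.hom ≫ D.w.unop.hom)) ▷ r ≫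
      (show u.hom ≫ D.w.unop.hom ⟶ v.hom from D.ω.hom.unop2.hom) ▷ r = _
  simp

/-- A diagonal for the opposite of the inclusion from data in the ambient bicategory. -/
def diagonalMk {A A₁ A₂ : S.Obj} {b : B} {r : A.obj ⟶ b} {f : A₁.obj ⟶ b} {u : A₂ ⟶ A₁}
    {v : A₂ ⟶ A} (α : f.op ≫ (opPseudofunctor S.inclusion).map u.op ≅
      r.op ≫ (opPseudofunctor S.inclusion).map v.op)
    (w : A₁ ⟶ A) (ν : f ≅ w.hom ≫ r) (ω : u.hom ≫ w.hom ≅ v.hom)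
    (e : (show u.hom ≫ f ⟶ v.hom ≫ r from α.hom.unop2) =
      u.hom ◁ ν.hom ≫ (α_ u.hom w.hom r).inv ≫ ω.hom ▷ r) :
    Diagonal (opPseudofunctor S.inclusion) (a := op A) (a₁ := op A₁) (a₂ := op A₂)
      (u := u.op) (v := v.op) α where
  w := w.op
  ν := ν.op2
  ω := (isoMk (f := u ≫ w) (g := v) ω).op2
  fac := congrArg op2 (by
    refine e.trans ?_
    change _ = u.hom ◁ ν.hom ≫ (α_ u.hom w.hom r).inv ≫ (𝟙 (u.hom ≫ w.hom)) ▷ r ≫ ω.hom ▷ r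
    simp)

/-- Since `u` is orthogonal to `r`, a 2-cell between fillers is the same as a compatible pair of
2-cells on the two sides. -/
theorem IsLeftPart.existsUnique_cell (h : S.IsLeftPart R) {A A₁ A₂ : S.Obj} {b : B}
    {r : A.obj ⟶ b} (hr : R r) {f f' : A₁.obj ⟶ b} {u : A₂ ⟶ A₁} {v : A₂ ⟶ A}
    {α : f.op ≫ (opPseudofunctor S.inclusion).map u.op ≅
      r.op ≫ (opPseudofunctor S.inclusion).map v.op}
    {α' : f'.op ≫ (opPseudofunctor S.inclusion).map u.op ≅
      r.op ≫ (opPseudofunctor S.inclusion).map v.op} (φ : f.op ⟶ f'.op)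
    (hφ : φ ▷ (opPseudofunctor S.inclusion).map u.op ≫ α'.hom = α.hom)
    (D : Diagonal (opPseudofunctor S.inclusion) (a := op A) (a₁ := op A₁) (a₂ := op A₂)
      (u := u.op) (v := v.op) α)
    (D' : Diagonal (opPseudofunctor S.inclusion) (a := op A) (a₁ := op A₁) (a₂ := op A₂)
      (u := u.op) (v := v.op) α') :
    ∃! σ : D.w ⟶ D'.w, Diagonal.Compatible φ D D' σ := by
  have e₁ := diagonal_fac D
  have e₂ := diagonal_fac D'
  have e₃ : u.hom ◁ φ.unop2 ≫ (show u.hom ≫ f' ⟶ v.hom ≫ r from α'.hom.unop2) =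
      (show u.hom ≫ f ⟶ v.hom ≫ r from α.hom.unop2) := congrArg Hom2.unop2 hφ
  let s : A₁.obj ⟶ A.obj := D.w.unop.hom
  let s' : A₁.obj ⟶ A.obj := D'.w.unop.hom
  let ν : f ≅ s ≫ r := D.ν.unop2
  let ν' : f' ≅ s' ≫ r := D'.ν.unop2
  let ω : u.hom ≫ s ≅ v.hom := S.inclusion.map₂Iso D.ω.unop2
  let ω' : u.hom ≫ s' ≅ v.hom := S.inclusion.map₂Iso D'.ω.unop2
  let χ : f ⟶ f' := φ.unop2
  have e : u.hom ◁ χ ≫ u.hom ◁ ν'.hom ≫ (α_ u.hom s' r).inv ≫ ω'.hom ▷ r =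
      u.hom ◁ ν.hom ≫ (α_ u.hom s r).inv ≫ ω.hom ▷ r :=
    (congrArg (u.hom ◁ χ ≫ ·) e₂).symm.trans (e₃.trans e₁)
  -- Compatibility of `σ` with the diagonals, solved for `u.hom ◁ σ` and `σ ▷ r` using invertibility
  -- of the structural 2-cells.
  have key : ∃! σ : s ⟶ s', u.hom ◁ σ = ω.hom ≫ ω'.inv ∧ σ ▷ r = ν.inv ≫ χ ≫ ν'.hom := by
    refine ((biOrth_iff _ _).1 (h.biOrth u.mem hr)).1 s s' _ _ ?_
    rw [comp_whiskerRight, Category.assoc, ← cancel_mono (α_ u.hom s' r).inv,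
      ← cancel_mono (ω'.hom ▷ r), ← cancel_epi (α_ u.hom s r).inv,
      ← cancel_epi (u.hom ◁ ν.hom)]
    simp [e]
  obtain ⟨σ, ⟨hσ, hσ'⟩, hu⟩ := key
  refine ⟨op2 (f := D.w.unop) (g := D'.w.unop) ⟨σ⟩, ⟨?_, ?_⟩, fun τ hτ => ?_⟩
  · refine congrArg op2 (SubBicat.hom₂_ext ?_)
    change ω.hom = u.hom ◁ σ ≫ ω'.hom
    simp [hσ]
  · refine congrArg op2 ?_
    change χ ≫ ν'.hom = ν.hom ≫ σ ▷ r
    simp [hσ']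
  · have h₁ : ω.hom = u.hom ◁ (show s ⟶ s' from τ.unop2.hom) ≫ ω'.hom :=
      congrArg (fun x => SubBicat.Hom₂.hom (Hom2.unop2 x)) hτ.1
    have h₂ : χ ≫ ν'.hom = ν.hom ≫ (show s ⟶ s' from τ.unop2.hom) ▷ r :=
      congrArg Hom2.unop2 hτ.2
    refine congrArg op2 (SubBicat.hom₂_ext (hu _ ⟨?_, ?_⟩))
    · rw [h₁]; simp
    · rw [h₂]; simp

theorem IsLeftPart.nonempty_diagonal (h : S.IsLeftPart R) {A A₁ A₂ : S.Obj} {b : B}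
    {r : A.obj ⟶ b} (hr : R r) {f : A₁.obj ⟶ b} {u : A₂ ⟶ A₁} {v : A₂ ⟶ A}
    (α : f.op ≫ (opPseudofunctor S.inclusion).map u.op ≅
      r.op ≫ (opPseudofunctor S.inclusion).map v.op) :
    Nonempty (Diagonal (opPseudofunctor S.inclusion) (a := op A) (a₁ := op A₁) (a₂ := op A₂)
      (u := u.op) (v := v.op) α) := by
  let β : u.hom ≫ f ≅ v.hom ≫ r := α.unop2
  obtain ⟨s, l, k, e⟩ := ((biOrth_iff _ _).1 (h.biOrth u.mem hr)).2 v.hom f β.symm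
  -- The filler lies in the sub-bicategory by right cancellation along `u.hom ≫ s ≅ v.hom`.
  refine ⟨diagonalMk α ⟨s, h.map_of_comp l u.mem v.mem⟩ k.symm l ?_⟩
  change β.hom = u.hom ◁ k.inv ≫ (α_ u.hom s r).inv ≫ l.hom ▷ r
  have e' : l.hom ▷ r = (α_ u.hom s r).hom ≫ u.hom ◁ k.hom ≫ β.hom := by
    rw [← reassoc_of% e]; simp
  simp [e']

theorem IsLeftPart.isGeneric (h : S.IsLeftPart R) {A : S.Obj} {b : B} {r : A.obj ⟶ b}
    (hr : R r) : IsGeneric (opPseudofunctor S.inclusion) (a := op A) r.op where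
  exists_diagonal {a₁ a₂} u v f α := by
    obtain ⟨D⟩ := h.nonempty_diagonal (A₁ := a₁.unop) (A₂ := a₂.unop) (f := f.unop)
      (u := u.unop) (v := v.unop) hr α
    have hf : 𝟙 f ▷ (opPseudofunctor S.inclusion).map u ≫ α.hom = α.hom := by simp
    have hc (D D' : Diagonal (opPseudofunctor S.inclusion) α) :
        ∃! σ : D.w ⟶ D'.w, Diagonal.Compatible (𝟙 f) D D' σ :=
      h.existsUnique_cell (A₁ := a₁.unop) (A₂ := a₂.unop) (f := f.unop) (f' := f.unop)
        (u := u.unop) (v := v.unop) hr (𝟙 f) hf D D'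
    refine ⟨D, fun D' => ?_⟩
    obtain ⟨σ, hσ, hu⟩ := hc D D'
    obtain ⟨τ, hτ, -⟩ := hc D' D
    -- The comparisons in the two directions are mutually inverse, by uniqueness of compatible
    -- endo-2-cells.
    refine ⟨⟨σ, τ, (hc D D).unique (hσ.trans hτ) (.refl D),
      (hc D' D').unique (hτ.trans hσ) (.refl D')⟩, hσ, fun ρ hρ => Iso.ext (hu _ hρ)⟩
  exists_unique_cell {a₁ a₂} u v f f' α α' φ hφ D D' :=
    h.existsUnique_cell (A₁ := a₁.unop) (A₂ := a₂.unop) (f := f.unop) (f' := f'.unop)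
        (u := u.unop) (v := v.unop) hr φ hφ D D'

theorem IsLeftPart.right_of_isGeneric (h : S.IsLeftPart R) {A : S.Obj} {b : B} {r : A.obj ⟶ b}
    (hr : IsGeneric (opPseudofunctor S.inclusion) (a := op A) r.op) : R r := by
  obtain ⟨m, l, r', hm, hl, hr', ⟨θ⟩⟩ := h.exists_fac r A.mem
  let M : S.Obj := ⟨m, hm⟩
  let l' : A ⟶ M := ⟨l, hl⟩
  have hg := h.isGeneric (A := M) hr'
  -- The factorization of `r`, read as a pseudosquare with identity left leg; its upper sides `r`
  -- and `r'` are both generic, so its diagonal is an equivalence.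
  let α : 𝟙 A.obj ≫ r ≅ l ≫ r' := λ_ r ≪≫ θ.symm
  obtain ⟨D, -⟩ := hg.exists_diagonal (a₁ := op A) (a₂ := op A) (𝟙 A : A ⟶ A).op l'.op r.op α.op2
  obtain ⟨e, he⟩ := hg.exists_equivalence hr D
  let k : r ≅ e.hom.unop.hom ≫ r' := D.ν.unop2 ≪≫ eqToIso (by rw [he]; rfl)
  -- Reversing 1-cells swaps the order of composites, so the counit of `e` plays the role of the
  -- unit, and conversely.
  exact h.right_of_quasiInverse (e' := e.inv.unop.hom) (S.inclusion.map₂Iso e.counit.symm.unop2)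
    (S.inclusion.map₂Iso e.unit.symm.unop2) k hr'

theorem IsLeftPart.isGeneric_iff (h : S.IsLeftPart R) (A : S.Obj) (b : B) (r : A.obj ⟶ b) :
    IsGeneric (opPseudofunctor S.inclusion) (a := op A) r.op ↔ R r :=
  ⟨h.right_of_isGeneric, h.isGeneric⟩

/-- Genericity of the competing `n'` yields the comparison and its uniqueness; genericity of the
chosen right part makes it an equivalence. -/
theorem IsLeftPart.isBistable (h : S.IsLeftPart R) :
    IsBistable (opPseudofunctor S.inclusion) := by
  intro b a f
  obtain ⟨m, l, r, hm, hl, hr, ⟨θ⟩⟩ := h.exists_fac f.unop a.unop.mem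
  let M : S.Obj := ⟨m, hm⟩
  let l' : a.unop ⟶ M := ⟨l, hl⟩
  have hg := h.isGeneric (A := M) hr
  refine ⟨op M, r.op, l'.op, θ.op2, hg, fun m' n' u' θ' hn' => ?_⟩
  obtain ⟨D, hD⟩ := hn'.exists_diagonal l'.op u' r.op
    ((show _ ≅ f from θ.op2) ≪≫ θ'.symm)
  exact ⟨D, hn'.exists_equivalence hg D, hD⟩

end SubBicat

/-! ### The two sub-bicategories of left objects. -/

section LeftObjects

variable {C : Type u} [Bicategory.{w, v} C] {L R : MorphismProperty C}

theorem isLeftPart_leftObj (h : IsBifactorizationSystem L R) {t : C} (ht : IsBiterminal t) :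
    (leftObj h t).IsLeftPart R where
  biOrth := h.biOrth
  map_of_comp := h.left_of_comp
  right_of_quasiInverse := h.right_of_quasiInverse
  exists_fac := by
    rintro a b f ⟨p, hp⟩
    obtain ⟨m, l, r, θ, hl, hr, -⟩ := h.exists_fac f
    obtain ⟨q⟩ := ht.nonempty_hom m
    obtain ⟨i⟩ := ht.nonempty_iso (l ≫ q) p
    -- The middle object is a left object: `l ≫ q` is isomorphic to `p` by biterminality, so `q` is
    -- in `L` by right cancellation.
    exact ⟨m, l, r, ⟨q, h.left_of_comp i hl hp⟩, hl, hr, ⟨θ⟩⟩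

/-! ### Orthogonality in the pseudoslice. -/

namespace PseudoSlice

variable {c : C}

/-- The invertible 2-cell of `C` underlying one of the pseudoslice. -/
def leftIso {X Y : PseudoSlice c} {f g : X ⟶ Y} (φ : f ≅ g) : f.left ≅ g.left where
  hom := φ.hom.left
  inv := φ.inv.left
  hom_inv_id := congrArg Hom₂.left φ.hom_inv_id
  inv_hom_id := congrArg Hom₂.left φ.inv_hom_id

/-- 1-cells of the pseudoslice are orthogonal as soon as their underlying 1-cells are. -/
theorem biOrth_of_left {X Y Z W : PseudoSlice c} {f : X ⟶ Y} {g : Z ⟶ W}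
    (h : BiOrth f.left g.left) : BiOrth f g := by
  rw [biOrth_iff] at h ⊢
  obtain ⟨h₁, h₂⟩ := h
  refine ⟨fun s t φ ψ e => ?_, fun u v α => ?_⟩
  · obtain ⟨σ, ⟨hσ, hσ'⟩, hu⟩ := h₁ s.left t.left φ.left ψ.left (congrArg Hom₂.left e)
    have hw : σ ▷ Z.hom ≫ t.iso.hom = s.iso.hom := by
      have := ψ.w
      rw [← hσ'] at this
      rw [← cancel_epi (s.left ◁ g.iso.hom), ← cancel_epi (α_ s.left g.left W.hom).hom]
      simpa [whisker_exchange_assoc] using this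
    refine ⟨⟨σ, hw⟩, ⟨Hom₂.ext hσ, Hom₂.ext hσ'⟩, fun τ hτ => Hom₂.ext (hu _ ⟨?_, ?_⟩)⟩
    · exact congrArg Hom₂.left hτ.1
    · exact congrArg Hom₂.left hτ.2
  · obtain ⟨s, l, r, e⟩ := h₂ u.left v.left (leftIso α)
    -- The triangle on `s` is forced by requiring `r` to be a 2-cell of the pseudoslice; the
    -- compatibility of `l` then has to be deduced from that of `α`.
    let i : s ≫ Z.hom ≅ Y.hom :=
      whiskerLeftIso s g.iso.symm ≪≫ (α_ _ _ _).symm ≪≫ whiskerRightIso r W.hom ≪≫ v.iso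
    refine ⟨⟨s, i⟩, isoMk l ?_, isoMk r ?_, Hom₂.ext e⟩
    · have hα : (leftIso α).hom ▷ W.hom ≫ (α_ _ _ _).hom ≫ f.left ◁ v.iso.hom ≫ f.iso.hom =
          (α_ _ _ _).hom ≫ u.left ◁ g.iso.hom ≫ u.iso.hom := α.hom.w
      have hr : f.left ◁ r.hom = (α_ _ _ _).inv ≫ l.hom ▷ g.left ≫ (leftIso α).hom := by
        simpa using (congrArg ((α_ f.left s g.left).inv ≫ ·) e).symm
      have hr' : f.left ◁ (r.hom ▷ W.hom) ≫ f.left ◁ v.iso.hom ≫ f.iso.hom =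
          (α_ _ _ _).inv ≫ ((α_ _ _ _).inv ≫ l.hom ▷ g.left) ▷ W.hom ≫ (α_ _ _ _).hom ≫
            u.left ◁ g.iso.hom ≫ u.iso.hom := by
        have hw : f.left ◁ (r.hom ▷ W.hom) =
            (α_ _ _ _).inv ≫ (f.left ◁ r.hom) ▷ W.hom ≫ (α_ _ _ _).hom := by simp
        rw [← hα, hw, hr]
        simp only [comp_whiskerRight, Category.assoc]
      have hl : l.hom ▷ Z.hom = (f.left ≫ s) ◁ g.iso.inv ≫ l.hom ▷ (g.left ≫ W.hom) ≫
          u.left ◁ g.iso.hom := by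
        rw [← whisker_exchange]; simp
      change l.hom ▷ Z.hom ≫ u.iso.hom =
        (α_ f.left s Z.hom).hom ≫ f.left ◁ i.hom ≫ f.iso.hom
      simp [i, hr', hl]
    · simp [i]

end PseudoSlice

theorem isLeftPart_leftObjOver (h : IsBifactorizationSystem L R) (c : C) :
    (leftObjOver h c).IsLeftPart (fun _ _ r => R r.left) where
  biOrth hf hg := PseudoSlice.biOrth_of_left (h.biOrth hf hg)
  map_of_comp i hf hk := h.left_of_comp (PseudoSlice.leftIso i) hf hk
  right_of_quasiInverse η κ _ _ i hr := h.right_of_quasiInverse (PseudoSlice.leftIso η)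
    (PseudoSlice.leftIso κ) (PseudoSlice.leftIso i) hr
  exists_fac := by
    intro a b f ha
    obtain ⟨m, l, r, θ, hl, hr, -⟩ := h.exists_fac f.left
    let i : l ≫ r ≫ b.hom ≅ a.hom := (α_ _ _ _).symm ≪≫ whiskerRightIso θ b.hom ≪≫ f.iso
    -- The middle object lies over `c` through `r ≫ b.hom`, which is in `L` by right cancellation,
    -- as `l` and `a.hom` are.
    exact ⟨⟨m, r ≫ b.hom⟩, ⟨l, i⟩, ⟨r, Iso.refl _⟩, h.left_of_comp i hl ha, hl, hr,
      ⟨PseudoSlice.isoMk θ (by simp [i])⟩⟩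

end LeftObjects

end BistableInclusion

open BistableInclusion
theorem mainTheorem3 {C : Type u} [Bicategory.{w, v} C] (L R : MorphismProperty C)
    (h : IsBifactorizationSystem L R) (t : C) (ht : IsBiterminal t) :
    (IsBistable (opPseudofunctor (leftObj h t).inclusion) ∧
      ∀ (A : (leftObj h t).Obj) (B : C) (r : A.obj ⟶ B),
        IsGeneric (opPseudofunctor (leftObj h t).inclusion) (a := op A) r.op ↔ R r) ∧
    ∀ c : C, IsBistable (opPseudofunctor (leftObjOver h c).inclusion) ∧
      ∀ (A : (leftObjOver h c).Obj) (B : PseudoSlice c) (r : A.obj ⟶ B),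
        IsGeneric (opPseudofunctor (leftObjOver h c).inclusion) (a := op A) r.op ↔ R r.left :=
  ⟨⟨(isLeftPart_leftObj h ht).isBistable, (isLeftPart_leftObj h ht).isGeneric_iff⟩, fun c =>
    ⟨(isLeftPart_leftObjOver h c).isBistable, (isLeftPart_leftObjOver h c).isGeneric_iff⟩⟩
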